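/- An \emph{involutive residuated lattice} (IRL) is an algebra $\mathbf A=\langle A;\cdot,\wedge,\vee,\neg,e\rangle$ such that $\langle A;\cdot,e\rangle$ is a commutative monoid, $\langle A;\wedge,\vee\rangle$ is a lattice (with order $\leqslant$), $\neg\neg x=x$, and $x\cdot y\leqslant z\iff \neg z\cdot y\leqslant\neg x$ for all $x,y,z$. Put $f:=\neg e$, $x\to y:=\neg(x\cdot\neg y)$ and $x^2:=x\cdot x$. A \emph{De Morgan monoid} is an IRL whose lattice reduct is distributive and which satisfies $x\leqslant x^2$. It is \emph{anti-idempotent} if it satisfies $x\leqslant f^2$. A \emph{Sugihara monoid} is an idempotent De Morgan monoid (i.e., $x^2=x$ for all $x$); it is \emph{odd} if $f=e$. An algebra is \emph{finitely subdirectly irreducible} (FSI) if, whenever the intersection of two of its congruences is the identity relation, one of the two is the identity relation (so trivial algebras are FSI). In a De Morgan monoid $\mathbf A$, the set $G=[\neg(f^2)):=\{x\in A: \neg(f^2)\leqslant x\}$ is a deductive filter (a lattice filter that is a submonoid of $\langle A;\cdot,e\rangle$), and $\mathbf A/[\neg(f^2))$ denotes the factor algebra of $\mathbf A$ by the congruence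 $\{\langle a,b\rangle : a\to b\in G \text{ and } b\to a\in G\}$. Let $\mathbf S$ be a totally ordered odd Sugihara monoid and $\mathbf B$ a De Morgan monoid. The \emph{rigorous extension} $\mathbf S[\mathbf B]$ is the algebra on the disjoint union $(S\setminus\{e^{\mathbf S}\})\cup B$, with neutral element $e^{\mathbf B}$, whose operations $\cdot,\wedge,\vee,\neg$ extend those of $\mathbf B$ and (restricted to $S\setminus\{e^{\mathbf S}\}$) those of $\mathbf S$, while for $\star\in\{\cdot,\wedge,\vee\}$, $b\in B$ and $s\in S\setminus\{e^{\mathbf S}\}$, both $b\star s$ and $s\star b$ are defined to be $b$ if $e^{\mathbf S}\star^{\mathbf S}s=e^{\mathbf S}$, and $e^{\mathbf S}\star^{\mathbf S}s$ otherwise. \textbf{Theorem.} Let $\mathbf A$ be an FSI De Morgan monoid. Then exactly one of the following two conditions holds. \begin{enumerate} \item $\mathbf A$ is a Sugihara monoid. \item The interval $[\neg(f^2),f^2]=\{x\in A:\neg(f^2)\leqslant x\leqslant f^2\}$ is the universe of a nontrivial anti-idempotent subalgebra $\mathbf A'$ of $\mathbf A$, the factor algebra $\mathbf S:=\mathbf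 A/[\neg(f^2))$ is a totally ordered odd Sugihara monoid, and $\mathbf A\cong\mathbf S[\mathbf A']$. \end{enumerate} -/

import Mathlib

universe u v

/-- An involutive (commutative) residuated lattice `⟨A; ·, ∧, ∨, ¬, e⟩`.  Fusion is `*`, the
neutral element `e` is `1`, the lattice operations are `⊓` and `⊔`, and the involution is `-`
(it satisfies `- -x = x`, as `InvolutiveNeg` says). -/
class IRL (A : Type u) extends CommMonoid A, Lattice A, InvolutiveNeg A where
  mul_le_iff : ∀ x y z : A, x * y ≤ z ↔ -z * y ≤ -x

/-- A De Morgan monoid: a distributive square-increasing IRL. -/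
class DeMorganMonoid (A : Type u) extends IRL A where
  inf_sup_distrib : ∀ x y z : A, x ⊓ (y ⊔ z) = (x ⊓ y) ⊔ (x ⊓ z)
  le_sq : ∀ x : A, x ≤ x ^ 2

namespace IRL

section Basic

variable {A : Type u} [IRL A]

/-- The constant `f = ¬e`. -/
def f (A : Type u) [IRL A] : A := -1

/-- The residual `x → y = ¬(x · ¬y)`. -/
def imp (x y : A) : A := -(x * -y)

theorem neg_le_neg_iff' (x y : A) : -x ≤ -y ↔ y ≤ x := by
  have h := mul_le_iff y 1 x
  simpa using h.symm

/-- The law of residuation. -/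
theorem le_imp_iff (x y z : A) : y ≤ imp x z ↔ x * y ≤ z := by
  unfold imp
  rw [← neg_le_neg_iff' (-(x * -z)) y, neg_neg, mul_comm x (-z), mul_comm x y, mul_le_iff y x z]

theorem mul_imp_le (x y : A) : x * imp x y ≤ y := (le_imp_iff x _ y).1 le_rfl

theorem mul_le_mul_left' {x y : A} (h : x ≤ y) (z : A) : z * x ≤ z * y :=
  (le_imp_iff z x _).1 (h.trans ((le_imp_iff z y _).2 le_rfl))

theorem mul_le_mul_both {x y z w : A} (h : x ≤ y) (k : z ≤ w) : x * z ≤ y * w :=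
  (mul_le_mul_left' k x).trans (by
    rw [mul_comm x w, mul_comm y w]; exact mul_le_mul_left' h w)

theorem imp_neg_neg (x y : A) : imp (-y) (-x) = imp x y := by
  simp [imp, mul_comm]

theorem neg_inf (x y : A) : -(x ⊓ y) = -x ⊔ -y := by
  apply le_antisymm
  · rw [← neg_le_neg_iff', neg_neg]
    apply le_inf
    · rw [← neg_le_neg_iff', neg_neg]; exact le_sup_left
    · rw [← neg_le_neg_iff', neg_neg]; exact le_sup_right
  · exact sup_le ((neg_le_neg_iff' _ _).2 inf_le_left) ((neg_le_neg_iff' _ _).2 inf_le_right)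

end Basic

/-- Congruences of an algebra `⟨A; ·, ∧, ∨, ¬, e⟩`: equivalence relations compatible with all
basic operations. -/
structure Congruence (A : Type u) [IRL A] extends Setoid A where
  mul' : ∀ {a b c d : A}, r a b → r c d → r (a * c) (b * d)
  inf' : ∀ {a b c d : A}, r a b → r c d → r (a ⊓ c) (b ⊓ d)
  sup' : ∀ {a b c d : A}, r a b → r c d → r (a ⊔ c) (b ⊔ d)
  neg' : ∀ {a b : A}, r a b → r (-a) (-b)

/-- Finitely subdirectly irreducible: the identity relation is meet-irreducible in the congruence
lattice, whose meet is the intersection.  (Trivial algebras are FSI.) -/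
def IsFSI (A : Type u) [IRL A] : Prop :=
  ∀ θ ψ : Congruence A, θ.toSetoid ⊓ ψ.toSetoid = ⊥ → θ.toSetoid = ⊥ ∨ ψ.toSetoid = ⊥

namespace Congruence

variable {A : Type u}

/-- The factor algebra `A/θ`. -/
def Factor [IRL A] (θ : Congruence A) : Type u := Quotient θ.toSetoid

section Ops

variable [IRL A] (θ : Congruence A)

instance : Mul θ.Factor :=
  ⟨Quotient.map₂ (· * ·) fun _ _ h _ _ k => θ.mul' h k⟩

instance : One θ.Factor := ⟨Quotient.mk _ 1⟩

instance : Min θ.Factor :=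
  ⟨Quotient.map₂ (· ⊓ ·) fun _ _ h _ _ k => θ.inf' h k⟩

instance : Max θ.Factor :=
  ⟨Quotient.map₂ (· ⊔ ·) fun _ _ h _ _ k => θ.sup' h k⟩

instance : Neg θ.Factor :=
  ⟨Quotient.map (fun a => -a) fun _ _ h => θ.neg' h⟩

/-- The canonical map `a ↦ a/θ`. -/
def cls (a : A) : θ.Factor := Quotient.mk _ a

theorem cls_surj (x : θ.Factor) : ∃ a, θ.cls a = x := Quotient.exists_rep x

theorem cls_mul (a b : A) : θ.cls (a * b) = θ.cls a * θ.cls b := rfl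
theorem cls_one : θ.cls 1 = 1 := rfl
theorem cls_inf (a b : A) : θ.cls (a ⊓ b) = θ.cls a ⊓ θ.cls b := rfl
theorem cls_sup (a b : A) : θ.cls (a ⊔ b) = θ.cls a ⊔ θ.cls b := rfl
theorem cls_neg (a : A) : θ.cls (-a) = -θ.cls a := rfl

instance : CommMonoid θ.Factor where
  mul_assoc x y z := by
    obtain ⟨a, rfl⟩ := θ.cls_surj x
    obtain ⟨b, rfl⟩ := θ.cls_surj y
    obtain ⟨c, rfl⟩ := θ.cls_surj z
    simp only [← cls_mul, mul_assoc]
  one_mul x := by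
    obtain ⟨a, rfl⟩ := θ.cls_surj x
    rw [← cls_one, ← cls_mul, one_mul]
  mul_one x := by
    obtain ⟨a, rfl⟩ := θ.cls_surj x
    rw [← cls_one, ← cls_mul, mul_one]
  mul_comm x y := by
    obtain ⟨a, rfl⟩ := θ.cls_surj x
    obtain ⟨b, rfl⟩ := θ.cls_surj y
    rw [← cls_mul, ← cls_mul, mul_comm]

instance : Lattice θ.Factor :=
  Lattice.mk'
    (fun x y => by
      obtain ⟨a, rfl⟩ := θ.cls_surj x
      obtain ⟨b, rfl⟩ := θ.cls_surj y
      rw [← cls_sup, ← cls_sup, sup_comm])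
    (fun x y z => by
      obtain ⟨a, rfl⟩ := θ.cls_surj x
      obtain ⟨b, rfl⟩ := θ.cls_surj y
      obtain ⟨c, rfl⟩ := θ.cls_surj z
      simp only [← cls_sup, sup_assoc])
    (fun x y => by
      obtain ⟨a, rfl⟩ := θ.cls_surj x
      obtain ⟨b, rfl⟩ := θ.cls_surj y
      rw [← cls_inf, ← cls_inf, inf_comm])
    (fun x y z => by
      obtain ⟨a, rfl⟩ := θ.cls_surj x
      obtain ⟨b, rfl⟩ := θ.cls_surj y
      obtain ⟨c, rfl⟩ := θ.cls_surj z
      simp only [← cls_inf, inf_assoc])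
    (fun x y => by
      obtain ⟨a, rfl⟩ := θ.cls_surj x
      obtain ⟨b, rfl⟩ := θ.cls_surj y
      rw [← cls_inf, ← cls_sup, sup_inf_self])
    (fun x y => by
      obtain ⟨a, rfl⟩ := θ.cls_surj x
      obtain ⟨b, rfl⟩ := θ.cls_surj y
      rw [← cls_sup, ← cls_inf, inf_sup_self])

theorem cls_le_iff (a b : A) : θ.cls a ≤ θ.cls b ↔ θ.cls (a ⊔ b) = θ.cls b := Iff.rfl

theorem cls_mono {a b : A} (h : a ≤ b) : θ.cls a ≤ θ.cls b := by
  rw [cls_le_iff, sup_eq_right.2 h]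

instance : InvolutiveNeg θ.Factor where
  neg_neg x := by
    obtain ⟨a, rfl⟩ := θ.cls_surj x
    rw [← cls_neg, ← cls_neg, neg_neg]

theorem factor_mul_le (a b c : A) (h : θ.cls a * θ.cls b ≤ θ.cls c) :
    -θ.cls c * θ.cls b ≤ -θ.cls a := by
  have h1 : θ.cls (a * b ⊔ c) = θ.cls c := (θ.cls_le_iff _ _).1 h
  have h2 : -(a * b ⊔ c) * b ≤ -a := (mul_le_iff a b _).1 le_sup_left
  have h3 := θ.cls_mono h2
  rwa [cls_mul, cls_neg, cls_neg, h1] at h3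

end Ops

instance [IRL A] (θ : Congruence A) : IRL θ.Factor where
  mul_le_iff x y z := by
    obtain ⟨a, rfl⟩ := θ.cls_surj x
    obtain ⟨b, rfl⟩ := θ.cls_surj y
    obtain ⟨c, rfl⟩ := θ.cls_surj z
    refine ⟨θ.factor_mul_le a b c, fun h => ?_⟩
    have := θ.factor_mul_le (-c) b (-a) h
    simpa only [cls_neg, neg_neg] using this

end Congruence

end IRL

namespace DeMorganMonoid

open IRL

variable {A : Type u}

/-- Factor algebras of De Morgan monoids are De Morgan monoids. -/
instance [DeMorganMonoid A] (θ : Congruence A) : DeMorganMonoid θ.Factor where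
  inf_sup_distrib x y z := by
    obtain ⟨a, rfl⟩ := θ.cls_surj x
    obtain ⟨b, rfl⟩ := θ.cls_surj y
    obtain ⟨c, rfl⟩ := θ.cls_surj z
    exact congrArg θ.cls (inf_sup_distrib a b c)
  le_sq x := by
    obtain ⟨a, rfl⟩ := θ.cls_surj x
    have h := θ.cls_mono (le_sq a)
    rw [pow_two] at h ⊢
    exact h

/-- A Sugihara monoid is an idempotent De Morgan monoid. -/
def IsSugihara (A : Type u) [DeMorganMonoid A] : Prop := ∀ a : A, a ^ 2 = a

/-- Oddness: `f = e`. -/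
def IsOdd (A : Type u) [DeMorganMonoid A] : Prop := f A = 1

/-- Totally ordered odd Sugihara monoids. -/
structure IsTotallyOrderedOddSugihara (S : Type u) [DeMorganMonoid S] : Prop where
  sugihara : IsSugihara S
  odd : IsOdd S
  total : ∀ a b : S, a ≤ b ∨ b ≤ a

/-- Anti-idempotence: the algebra satisfies `x ≤ f²`. -/
def IsAntiIdempotent (A : Type u) [DeMorganMonoid A] : Prop := ∀ a : A, a ≤ f A ^ 2

theorem inf_le_mul [DeMorganMonoid A] (a b : A) : a ⊓ b ≤ a * b :=
  (le_sq (a ⊓ b)).trans (by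
    rw [pow_two]; exact mul_le_mul_both inf_le_left inf_le_right)

end DeMorganMonoid

namespace IRL

/-- Deductive filters: lattice filters that are submonoids of `⟨A; ·, e⟩`. -/
structure DeductiveFilter (A : Type u) [IRL A] extends Submonoid A where
  mem_of_le' : ∀ {a b : A}, a ∈ carrier → a ≤ b → b ∈ carrier
  inf_mem' : ∀ {a b : A}, a ∈ carrier → b ∈ carrier → a ⊓ b ∈ carrier

section Leibniz

variable {A : Type u} [IRL A]

namespace DeductiveFilter

variable (G : DeductiveFilter A)

theorem imp_mul_mem {a b : A} (h : imp a b ∈ G.carrier) (c : A) :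
    imp (a * c) (b * c) ∈ G.carrier := by
  refine G.mem_of_le' h ((le_imp_iff _ _ _).2 ?_)
  rw [mul_right_comm]
  exact mul_le_mul_both (mul_imp_le a b) le_rfl

theorem imp_inf_mem {a b : A} (h : imp a b ∈ G.carrier) (c : A) :
    imp (a ⊓ c) (b ⊓ c) ∈ G.carrier := by
  refine G.mem_of_le' (G.inf_mem' h G.one_mem') ((le_imp_iff _ _ _).2 (le_inf ?_ ?_))
  · exact (mul_le_mul_both inf_le_left inf_le_left).trans (mul_imp_le a b)
  · exact (mul_le_mul_both inf_le_right inf_le_right).trans (mul_one c).le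

theorem imp_trans_mem {a b c : A} (h : imp a b ∈ G.carrier) (k : imp b c ∈ G.carrier) :
    imp a c ∈ G.carrier := by
  refine G.mem_of_le' (G.mul_mem' h k) ((le_imp_iff _ _ _).2 ?_)
  rw [← mul_assoc]
  exact (mul_le_mul_both (mul_imp_le a b) le_rfl).trans (mul_imp_le b c)

theorem imp_neg_mem {a b : A} (h : imp a b ∈ G.carrier) : imp (-b) (-a) ∈ G.carrier := by
  rwa [imp_neg_neg]

theorem imp_sup_mem {a b : A} (h : imp a b ∈ G.carrier) (c : A) :
    imp (a ⊔ c) (b ⊔ c) ∈ G.carrier := by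
  have := G.imp_neg_mem (G.imp_inf_mem (G.imp_neg_mem h) (-c))
  simpa only [neg_inf, neg_neg] using this

theorem imp_self_mem (a : A) : imp a a ∈ G.carrier :=
  G.mem_of_le' G.one_mem' ((le_imp_iff _ _ _).2 (mul_one a).le)

/-- The Leibniz congruence of `G`: `a` and `b` are related iff `a → b` and `b → a` are in `G`. -/
def leibniz : Congruence A where
  r a b := imp a b ∈ G.carrier ∧ imp b a ∈ G.carrier
  iseqv :=
    { refl := fun a => ⟨G.imp_self_mem a, G.imp_self_mem a⟩
      symm := fun h => ⟨h.2, h.1⟩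
      trans := fun h k => ⟨G.imp_trans_mem h.1 k.1, G.imp_trans_mem k.2 h.2⟩ }
  mul' := by
    intro a b c d h k
    have e1 := G.imp_mul_mem k.1 b
    have e2 := G.imp_mul_mem k.2 b
    rw [mul_comm c, mul_comm d] at e1 e2
    exact ⟨G.imp_trans_mem (G.imp_mul_mem h.1 c) e1, G.imp_trans_mem e2 (G.imp_mul_mem h.2 c)⟩
  inf' := by
    intro a b c d h k
    have e1 := G.imp_inf_mem k.1 b
    have e2 := G.imp_inf_mem k.2 b
    rw [inf_comm c, inf_comm d] at e1 e2
    exact ⟨G.imp_trans_mem (G.imp_inf_mem h.1 c) e1, G.imp_trans_mem e2 (G.imp_inf_mem h.2 c)⟩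
  sup' := by
    intro a b c d h k
    have e1 := G.imp_sup_mem k.1 b
    have e2 := G.imp_sup_mem k.2 b
    rw [sup_comm c, sup_comm d] at e1 e2
    exact ⟨G.imp_trans_mem (G.imp_sup_mem h.1 c) e1, G.imp_trans_mem e2 (G.imp_sup_mem h.2 c)⟩
  neg' := fun h => ⟨G.imp_neg_mem h.2, G.imp_neg_mem h.1⟩

end DeductiveFilter

end Leibniz

/-- Subalgebras of `⟨A; ·, ∧, ∨, ¬, e⟩`. -/
structure Subalg (A : Type u) [IRL A] extends Submonoid A, Sublattice A where
  neg_mem' : ∀ {a : A}, a ∈ carrier → -a ∈ carrier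

end IRL

namespace DeMorganMonoid

open IRL

/-- The filter `[¬(f²))` of all upper bounds of `¬(f²)`. -/
def topFilter (A : Type u) [DeMorganMonoid A] : DeductiveFilter A where
  carrier := Set.Ici (-(f A ^ 2))
  one_mem' := by
    change -(f A ^ 2) ≤ 1
    rw [← neg_le_neg_iff', neg_neg]
    exact le_sq (f A)
  mul_mem' := fun {a b} ha hb => (le_inf ha hb).trans (inf_le_mul a b)
  mem_of_le' := fun ha h => le_trans ha h
  inf_mem' := fun ha hb => le_inf ha hb

/-- The factor algebra `A/[¬(f²))`. -/
abbrev TopFactor (A : Type u) [DeMorganMonoid A] : Type u := (topFilter A).leibniz.Factor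

section Subalg

variable {A : Type u} [DeMorganMonoid A]

/-- The universe of a subalgebra, as a type. -/
def SubalgType (B : Subalg A) : Type u := {a : A // a ∈ B.carrier}

instance (B : Subalg A) : CommMonoid (SubalgType B) :=
  inferInstanceAs (CommMonoid B.toSubmonoid)

instance (B : Subalg A) : Lattice (SubalgType B) :=
  inferInstanceAs (Lattice B.toSublattice)

instance (B : Subalg A) : InvolutiveNeg (SubalgType B) where
  neg a := ⟨-a.1, B.neg_mem' a.2⟩
  neg_neg a := Subtype.ext (neg_neg a.1)

/-- A subalgebra of a De Morgan monoid, with the restricted operations. -/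
instance (B : Subalg A) : DeMorganMonoid (SubalgType B) where
  mul_le_iff x y z := mul_le_iff x.1 y.1 z.1
  inf_sup_distrib x y z := Subtype.ext (inf_sup_distrib x.1 y.1 z.1)
  le_sq x := le_sq x.1

end Subalg

/-- The universe `(S \ {e}) ∪ A` (a disjoint union) of the rigorous extension `S[A]` of a
De Morgan monoid `A` by a totally ordered odd Sugihara monoid `S`. -/
def RigorousExtension (S : Type u) (A : Type v) [DeMorganMonoid S] [DeMorganMonoid A]
    (_hS : IsTotallyOrderedOddSugihara S) : Type (max u v) :=
  {s : S // s ≠ 1} ⊕ A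

namespace RigorousExtension

variable {S : Type u} {A : Type v} [DeMorganMonoid S] [DeMorganMonoid A]
  {hS : IsTotallyOrderedOddSugihara S}

open Classical in
/-- The value of `a ⋆' s` and of `s ⋆' a`, for `a` in `A` and `s` in `S \ {e}`:
it is `a` if `e ⋆ s = e` in `S`, and `e ⋆ s` otherwise. -/
noncomputable def mixed (op : S → S → S) (a : A) (s : {s : S // s ≠ 1}) :
    RigorousExtension S A hS :=
  if h : op 1 s.1 = 1 then Sum.inr a else Sum.inl ⟨op 1 s.1, h⟩

/-- The operation `⋆'` on `(S \ {e}) ∪ A` that extends the operations `⋆` of `S` and `A`. -/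
noncomputable def extOp (opS : S → S → S) (opA : A → A → A)
    (hop : ∀ s p : S, s ≠ 1 → p ≠ 1 → opS s p ≠ 1) :
    RigorousExtension S A hS → RigorousExtension S A hS → RigorousExtension S A hS
  | Sum.inl s, Sum.inl p => Sum.inl ⟨opS s.1 p.1, hop s.1 p.1 s.2 p.2⟩
  | Sum.inr a, Sum.inr b => Sum.inr (opA a b)
  | Sum.inr a, Sum.inl s => mixed opS a s
  | Sum.inl s, Sum.inr a => mixed opS a s

noncomputable instance : Mul (RigorousExtension S A hS) :=
  ⟨extOp (· * ·) (· * ·) (by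
    intro s p hs _ h
    apply hs
    have h' : s * p = 1 := h
    have hss : s * s = s := by rw [← pow_two]; exact hS.sugihara s
    calc s = s * (s * p) := by rw [h', mul_one]
      _ = s * p := by rw [← mul_assoc, hss]
      _ = 1 := h')⟩

noncomputable instance : Min (RigorousExtension S A hS) :=
  ⟨extOp (· ⊓ ·) (· ⊓ ·) (by
    intro s p hs hp
    rcases hS.total s p with h | h
    · simpa [inf_eq_left.2 h] using hs
    · simpa [inf_eq_right.2 h] using hp)⟩

noncomputable instance : Max (RigorousExtension S A hS) :=
  ⟨extOp (· ⊔ ·) (· ⊔ ·) (by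
    intro s p hs hp
    rcases hS.total s p with h | h
    · simpa [sup_eq_right.2 h] using hp
    · simpa [sup_eq_left.2 h] using hs)⟩

instance : Neg (RigorousExtension S A hS) :=
  ⟨fun x => match x with
    | Sum.inl s => Sum.inl ⟨-s.1, fun h => s.2 (by
        have h1 : -(1 : S) = 1 := hS.odd
        rw [← neg_neg s.1, h, h1])⟩
    | Sum.inr a => Sum.inr (-a)⟩

instance : One (RigorousExtension S A hS) := ⟨Sum.inr 1⟩

end RigorousExtension

end DeMorganMonoid

/-- Isomorphisms of algebras of the signature `⟨·, ∧, ∨, ¬, e⟩`. -/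
structure IRLIso (A : Type u) (B : Type v) [Mul A] [Min A] [Max A] [Neg A] [One A]
    [Mul B] [Min B] [Max B] [Neg B] [One B] extends A ≃ B where
  map_mul' : ∀ x y : A, toFun (x * y) = toFun x * toFun y
  map_inf' : ∀ x y : A, toFun (x ⊓ y) = toFun x ⊓ toFun y
  map_sup' : ∀ x y : A, toFun (x ⊔ y) = toFun x ⊔ toFun y
  map_neg' : ∀ x : A, toFun (-x) = -toFun x
  map_one' : toFun 1 = 1

/-! Everything is driven by the law that `x * -y ≤ f` iff `x ≤ y`. In an FSI algebra `e` is
join-prime (`one_le_or_of_one_le_sup`), so every element is above `e` or below `f`; applied to `x *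
-y` this gives `x ≤ y` or `e ≤ x * -y`, the source of all comparabilities (`le_or_one_le_mul_neg`).

If `f ≤ e`, the algebra is idempotent. Otherwise `e ≤ f²`. Since `f²` is idempotent and `f² · ¬(f²)
≤ ¬(f²)`, the interval is a subalgebra. An element outside it is fixed by fusion with `¬(f²)`
(`mul_bot'_of_notMem`), and hence with any interval element; it is also comparable with every
element. Modulo `[¬(f²))` the interval is exactly the class of `e`, and distinct outside elements
stay distinct. So keeping the interval and sending every other element to its class is a bijection
onto the rigorous extension, and the absorption and comparability facts are what its mixed
operations require. -/

namespace IRL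

/-! ### Involution and the constant `f`. -/

section Arithmetic

variable {A : Type u} [IRL A]

theorem neg_le_iff (x y : A) : -x ≤ y ↔ -y ≤ x := by
  rw [← neg_le_neg_iff' y (-x), neg_neg]

theorem le_neg_iff (x y : A) : x ≤ -y ↔ y ≤ -x := by
  rw [← neg_le_neg_iff' (-y) x, neg_neg]

theorem mul_neg_le_f_iff (x y : A) : x * -y ≤ f A ↔ x ≤ y := by
  rw [mul_comm, mul_le_iff]
  simp [f]

theorem mul_neg_self_le (x : A) : x * -x ≤ f A := (mul_neg_le_f_iff x x).2 le_rfl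

end Arithmetic

end IRL

namespace DeMorganMonoid

open IRL

/-! ### Consequences of FSI, and the arithmetic of `f²`. -/

section Basic

variable {A : Type u} [DeMorganMonoid A]

theorem le_mul_self (x : A) : x ≤ x * x := by
  simpa [pow_two] using le_sq x

theorem mul_self_eq_of_le_one {x : A} (h : x ≤ 1) : x * x = x :=
  le_antisymm ((mul_le_mul_left' h x).trans (mul_one x).le) (le_mul_self x)

/-- The deductive filter of all upper bounds of an element below `e`. -/
def principalFilter (x : A) (hx : x ≤ 1) : DeductiveFilter A where
  carrier := Set.Ici x
  one_mem' := hx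
  mul_mem' := fun ha hb => (le_inf ha hb).trans (inf_le_mul _ _)
  mem_of_le' := fun ha h => le_trans ha h
  inf_mem' := fun ha hb => le_inf ha hb

theorem eq_one_of_leibniz_principalFilter_eq_bot {x : A} {hx : x ≤ 1}
    (h : (principalFilter x hx).leibniz.toSetoid = ⊥) : x = 1 := by
  have hr : (principalFilter x hx).leibniz.toSetoid x 1 := by
    refine ⟨(le_imp_iff _ _ _).2 ?_, (le_imp_iff _ _ _).2 (one_mul x).le⟩
    rw [mul_self_eq_of_le_one hx]
    exact hx
  rw [h] at hr
  exact hr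

/-- In an FSI De Morgan monoid, `e` is join-prime. -/
theorem one_le_or_of_one_le_sup (hA : IsFSI A) {x y : A} (h : 1 ≤ x ⊔ y) : 1 ≤ x ∨ 1 ≤ y := by
  have hsup : (1 ⊓ x) ⊔ (1 ⊓ y) = (1 : A) := by
    rw [← inf_sup_distrib, inf_eq_left.2 h]
  -- A pair in both congruences has its implications above both `1 ⊓ x` and `1 ⊓ y`, hence above
  -- their join `1`, so its members are equal.
  have hbot := hA (principalFilter (1 ⊓ x) inf_le_left).leibniz
    (principalFilter (1 ⊓ y) inf_le_left).leibniz (by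
      rw [eq_bot_iff]
      rintro p q ⟨⟨h1, h2⟩, ⟨h3, h4⟩⟩
      have h5 : 1 ≤ imp p q := hsup ▸ sup_le h1 h3
      have h6 : 1 ≤ imp q p := hsup ▸ sup_le h2 h4
      rw [le_imp_iff, mul_one] at h5 h6
      exact le_antisymm h5 h6)
  exact hbot.imp
    (fun k => inf_eq_left.1 (eq_one_of_leibniz_principalFilter_eq_bot k))
    (fun k => inf_eq_left.1 (eq_one_of_leibniz_principalFilter_eq_bot k))

/-- Excluded middle `1 ≤ x ⊔ -x` holds because `x ⊓ -x ≤ x * -x ≤ f`; join-primeness of `1` then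
splits it. -/
theorem one_le_or_le_f (hA : IsFSI A) (x : A) : 1 ≤ x ∨ x ≤ f A := by
  have h : 1 ≤ x ⊔ -x := by
    rw [show x ⊔ -x = -(x ⊓ -x) by rw [IRL.neg_inf, neg_neg, sup_comm], le_neg_iff]
    exact (inf_le_mul _ _).trans (mul_neg_self_le x)
  refine (one_le_or_of_one_le_sup hA h).imp_right fun k => ?_
  rwa [le_neg_iff] at k

theorem le_or_one_le_mul_neg (hA : IsFSI A) (x y : A) : x ≤ y ∨ 1 ≤ x * -y :=
  (one_le_or_le_f hA (x * -y)).symm.imp_left (mul_neg_le_f_iff x y).1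

theorem isSugihara_of_f_le_one (h : f A ≤ 1) : IsSugihara A := by
  intro x
  refine le_antisymm ?_ (le_sq x)
  rw [← mul_neg_le_f_iff, pow_two]
  -- Duplicating `-x` turns the product into the square of `x * -x`, which is below `f * 1`.
  calc x * x * -x ≤ x * x * (-x * -x) := mul_le_mul_left' (le_mul_self _) _
    _ = (x * -x) * (x * -x) := mul_mul_mul_comm _ _ _ _
    _ ≤ f A * 1 := mul_le_mul_both (mul_neg_self_le x) ((mul_neg_self_le x).trans h)
    _ = f A := mul_one _

theorem IsSugihara.f_le_one (h : IsSugihara A) : f A ≤ 1 := by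
  rw [← mul_neg_le_f_iff]
  exact ((pow_two _).symm.trans (h (f A))).le

/-- The least element `¬(f²)` of the interval `[¬(f²), f²]`. -/
abbrev bot' (A : Type u) [DeMorganMonoid A] : A := -(f A ^ 2)

theorem bot'_le_one : bot' A ≤ 1 := (topFilter A).one_mem'

/-- Since `f = -1`, the claim amounts to `f² · ¬(f²) ≤ f`. -/
theorem bot'_mul_f_le_one : bot' A * f A ≤ 1 := by
  rw [← mul_neg_le_f_iff, mul_assoc]
  change bot' A * (f A * f A) ≤ _
  rw [← pow_two, mul_comm]
  exact mul_neg_self_le _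

theorem bot'_mul_self : bot' A * bot' A = bot' A := mul_self_eq_of_le_one bot'_le_one

/-- The crux is `f³ ≤ f²`, that is, `f³ · ¬(f²) ≤ f`: idempotence of `¬(f²)` supplies a second copy,
and each copy cancels one factor `f`. -/
theorem f_sq_mul_f_sq : f A ^ 2 * f A ^ 2 = f A ^ 2 := by
  have key : f A ^ 2 * f A ≤ f A ^ 2 := by
    rw [← mul_neg_le_f_iff]
    calc f A ^ 2 * f A * bot' A = f A ^ 2 * f A * (bot' A * bot' A) := by rw [bot'_mul_self]
      _ = (bot' A * f A) * (bot' A * f A) * f A := by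
        rw [pow_two]; ac_rfl
      _ ≤ 1 * 1 * f A := mul_le_mul_both
          (mul_le_mul_both bot'_mul_f_le_one bot'_mul_f_le_one) le_rfl
      _ = f A := by simp
  refine le_antisymm ?_ (le_mul_self _)
  calc f A ^ 2 * f A ^ 2 = f A ^ 2 * f A * f A := by rw [pow_two]; ac_rfl
    _ ≤ f A ^ 2 * f A := mul_le_mul_both key le_rfl
    _ ≤ f A ^ 2 := key

theorem f_sq_mul_bot'_le : f A ^ 2 * bot' A ≤ bot' A := by
  rw [← mul_neg_le_f_iff]
  change f A ^ 2 * bot' A * - -(f A ^ 2) ≤ _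
  rw [neg_neg, mul_right_comm, f_sq_mul_f_sq]
  exact mul_neg_self_le _

theorem cls_eq_cls_iff (x y : A) :
    (topFilter A).leibniz.cls x = (topFilter A).leibniz.cls y ↔
      bot' A * x ≤ y ∧ bot' A * y ≤ x := by
  have h : (topFilter A).leibniz.cls x = (topFilter A).leibniz.cls y ↔
      bot' A ≤ imp x y ∧ bot' A ≤ imp y x := Quotient.eq
  rw [h, le_imp_iff, le_imp_iff, mul_comm x, mul_comm y]

end Basic

/-! ### The interval `[¬(f²), f²]`, the elements outside it, and the top factor. -/

section Interval

variable {A : Type u} [DeMorganMonoid A]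

/-- Otherwise `f² ≤ f`, that is `f * -1 ≤ f`, which means `f ≤ 1`. -/
theorem one_le_f_sq (hA : IsFSI A) (hn : ¬ IsSugihara A) : 1 ≤ f A ^ 2 := by
  refine (one_le_or_le_f hA _).resolve_right fun h => hn (isSugihara_of_f_le_one ?_)
  rw [pow_two] at h
  exact (mul_neg_le_f_iff (f A) 1).1 h

theorem bot'_le_f (h1 : 1 ≤ f A ^ 2) : bot' A ≤ f A := (neg_le_neg_iff' _ _).2 h1

theorem mem_Icc_neg {x : A} (hx : x ∈ Set.Icc (bot' A) (f A ^ 2)) :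
    -x ∈ Set.Icc (bot' A) (f A ^ 2) :=
  ⟨(neg_le_neg_iff' _ _).2 hx.2, (neg_le_iff _ _).2 hx.1⟩

theorem mem_Icc_mul {x y : A} (hx : x ∈ Set.Icc (bot' A) (f A ^ 2))
    (hy : y ∈ Set.Icc (bot' A) (f A ^ 2)) : x * y ∈ Set.Icc (bot' A) (f A ^ 2) :=
  ⟨bot'_mul_self.ge.trans (mul_le_mul_both hx.1 hy.1),
    (mul_le_mul_both hx.2 hy.2).trans f_sq_mul_f_sq.le⟩

/-- The subalgebra of a non-idempotent FSI De Morgan monoid on the interval `[¬(f²), f²]`. -/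
def intervalSubalg (h1 : 1 ≤ f A ^ 2) : Subalg A where
  carrier := Set.Icc (bot' A) (f A ^ 2)
  mul_mem' := mem_Icc_mul
  one_mem' := ⟨bot'_le_one, h1⟩
  supClosed' := fun _ hx _ hy => ⟨hx.1.trans le_sup_left, sup_le hx.2 hy.2⟩
  infClosed' := fun _ hx _ hy => ⟨le_inf hx.1 hy.1, inf_le_left.trans hx.2⟩
  neg_mem' := mem_Icc_neg

/-- Every element is comparable with `f²`. -/
theorem le_f_sq_or_f_sq_le (hA : IsFSI A) (x : A) :
    x ≤ f A ^ 2 ∨ (f A ^ 2 ≤ x * bot' A ∧ f A ^ 2 ≤ x) := by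
  refine (le_or_one_le_mul_neg hA x (f A ^ 2)).imp_right fun h => ?_
  -- Multiply `1 ≤ x * bot' A` by `f²`, which `bot' A` absorbs.
  have h2 : f A ^ 2 ≤ x * bot' A := by
    calc f A ^ 2 = f A ^ 2 * 1 := (mul_one _).symm
      _ ≤ f A ^ 2 * (x * bot' A) := mul_le_mul_left' h _
      _ = x * (f A ^ 2 * bot' A) := mul_left_comm _ _ _
      _ ≤ x * bot' A := mul_le_mul_left' f_sq_mul_bot'_le _
  exact ⟨h2, h2.trans ((mul_le_mul_left' bot'_le_one x).trans (mul_one x).le)⟩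

theorem bot'_le_or_le_bot' (hA : IsFSI A) (x : A) : bot' A ≤ x ∨ x ≤ bot' A := by
  refine (le_f_sq_or_f_sq_le hA (-x)).imp (fun h => (neg_le_iff _ _).1 h) fun h => ?_
  exact (le_neg_iff _ _).1 h.2

/-- An element outside the interval `[¬(f²), f²]` lies strictly below or strictly above it. -/
theorem le_bot'_or_f_sq_le (hA : IsFSI A) {x : A} (hx : x ∉ Set.Icc (bot' A) (f A ^ 2)) :
    (x ≤ bot' A ∧ ¬ bot' A ≤ x) ∨ (f A ^ 2 ≤ x ∧ ¬ x ≤ f A ^ 2) := by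
  by_cases h : bot' A ≤ x
  · have h2 : ¬ x ≤ f A ^ 2 := fun k => hx ⟨h, k⟩
    exact .inr ⟨((le_f_sq_or_f_sq_le hA x).resolve_left h2).2, h2⟩
  · exact .inl ⟨(bot'_le_or_le_bot' hA x).resolve_left h, h⟩

theorem mul_bot'_of_not_le (hA : IsFSI A) (h1 : 1 ≤ f A ^ 2) {x : A} (hx : ¬ x ≤ f A ^ 2) :
    x * bot' A = x := by
  refine le_antisymm ((mul_le_mul_left' bot'_le_one x).trans (mul_one x).le) ?_
  have h2 := ((le_f_sq_or_f_sq_le hA x).resolve_left hx).1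
  -- This `w` is the residual `x → f²`, so `x * w ≤ f²`; being below `1` it is idempotent, and the
  -- spare copy of `w` brings the bound down to `bot' A`.
  set w := -(x * bot' A) with hw
  have hwa : w ≤ bot' A := (neg_le_neg_iff' _ _).2 h2
  have hxw : x * w ≤ f A ^ 2 := mul_imp_le x (f A ^ 2)
  rw [← mul_neg_le_f_iff]
  calc x * w = x * w * w := by rw [mul_assoc, mul_self_eq_of_le_one (hwa.trans bot'_le_one)]
    _ ≤ f A ^ 2 * bot' A := mul_le_mul_both hxw hwa
    _ ≤ bot' A := f_sq_mul_bot'_le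
    _ ≤ f A := bot'_le_f h1

theorem mul_bot'_of_notMem (hA : IsFSI A) (h1 : 1 ≤ f A ^ 2) {x : A}
    (hx : x ∉ Set.Icc (bot' A) (f A ^ 2)) : x * bot' A = x := by
  rcases le_bot'_or_f_sq_le hA hx with h | h
  · refine le_antisymm ((mul_le_mul_left' bot'_le_one x).trans (mul_one x).le) ?_
    exact (le_mul_self x).trans (mul_le_mul_left' h.1 x)
  · exact mul_bot'_of_not_le hA h1 h.2

/-- Elements of the interval `[¬(f²), f²]` act trivially on the elements outside it. -/
theorem mul_eq_of_notMem (hA : IsFSI A) (h1 : 1 ≤ f A ^ 2) {x b : A}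
    (hx : x ∉ Set.Icc (bot' A) (f A ^ 2)) (hb : b ∈ Set.Icc (bot' A) (f A ^ 2)) :
    x * b = x := by
  have h := mul_bot'_of_notMem hA h1 hx
  apply le_antisymm
  · calc x * b ≤ x * f A ^ 2 := mul_le_mul_left' hb.2 x
      _ = x * bot' A * f A ^ 2 := by rw [h]
      _ = x * (f A ^ 2 * bot' A) := by rw [mul_assoc, mul_comm (bot' A)]
      _ ≤ x * bot' A := mul_le_mul_left' f_sq_mul_bot'_le x
      _ = x := h
  · exact h.ge.trans (mul_le_mul_left' hb.1 x)

theorem mul_bot'_le_f_iff (x : A) : x * bot' A ≤ f A ↔ x ≤ f A ^ 2 := mul_neg_le_f_iff x _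

theorem cls_eq_one_iff (h1 : 1 ≤ f A ^ 2) (x : A) :
    (topFilter A).leibniz.cls x = 1 ↔ x ∈ Set.Icc (bot' A) (f A ^ 2) := by
  rw [← Congruence.cls_one, cls_eq_cls_iff, mul_one]
  constructor
  · rintro ⟨h, h'⟩
    refine ⟨h', (mul_bot'_le_f_iff x).1 ?_⟩
    calc x * bot' A = bot' A * (bot' A * x) := by rw [← mul_assoc, bot'_mul_self, mul_comm]
      _ ≤ bot' A * 1 := mul_le_mul_left' h _
      _ ≤ f A := (mul_one _).le.trans (bot'_le_f h1)
  · rintro ⟨h, h'⟩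
    refine ⟨(mul_le_mul_left' h' _).trans ?_, h⟩
    rw [mul_comm]
    exact f_sq_mul_bot'_le.trans bot'_le_one

/-- Congruence means equality up to a factor `bot' A`, and that factor acts as the identity outside
the interval. -/
theorem eq_of_cls_eq (hA : IsFSI A) (h1 : 1 ≤ f A ^ 2) {x y : A}
    (hx : x ∉ Set.Icc (bot' A) (f A ^ 2)) (hy : y ∉ Set.Icc (bot' A) (f A ^ 2))
    (h : (topFilter A).leibniz.cls x = (topFilter A).leibniz.cls y) : x = y := by
  rw [cls_eq_cls_iff, mul_comm, mul_bot'_of_notMem hA h1 hx, mul_comm,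
    mul_bot'_of_notMem hA h1 hy] at h
  exact le_antisymm h.1 h.2

theorem le_total_of_not_le (hA : IsFSI A) (h1 : 1 ≤ f A ^ 2) {x : A} (y : A)
    (hx : ¬ x ≤ f A ^ 2) : x ≤ y ∨ y ≤ x := by
  refine (le_or_one_le_mul_neg hA x y).imp_right fun h => ?_
  have hf : f A ∈ Set.Icc (bot' A) (f A ^ 2) := ⟨bot'_le_f h1, le_sq _⟩
  -- Multiplying `1 ≤ x * -y` by `y` leaves `x * f`, and `x` absorbs `f` because `f` lies in the
  -- interval.
  calc y = y * 1 := (mul_one y).symm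
    _ ≤ y * (x * -y) := mul_le_mul_left' h y
    _ = x * (y * -y) := mul_left_comm _ _ _
    _ ≤ x * f A := mul_le_mul_left' (mul_neg_self_le y) x
    _ = x := mul_eq_of_notMem hA h1 (fun k => hx k.2) hf

theorem le_total_of_notMem (hA : IsFSI A) (h1 : 1 ≤ f A ^ 2) {x : A} (y : A)
    (hx : x ∉ Set.Icc (bot' A) (f A ^ 2)) : x ≤ y ∨ y ≤ x := by
  rcases le_bot'_or_f_sq_le hA hx with h | h
  · have := le_total_of_not_le hA h1 (-y) (x := -x) fun k => h.2 ((neg_le_iff _ _).1 k)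
    rwa [neg_le_neg_iff', neg_le_neg_iff', or_comm] at this
  · exact le_total_of_not_le hA h1 y h.2

theorem isTotallyOrderedOddSugihara_topFactor (hA : IsFSI A) (h1 : 1 ≤ f A ^ 2) :
    IsTotallyOrderedOddSugihara (TopFactor A) := by
  -- Oddness already gives idempotence, by the criterion `f ≤ 1`.
  have hodd : IsOdd (TopFactor A) :=
    (cls_eq_one_iff h1 (f A)).2 ⟨bot'_le_f h1, le_sq _⟩
  refine ⟨isSugihara_of_f_le_one (le_of_eq hodd), hodd, fun p q => ?_⟩
  obtain ⟨x, rfl⟩ := Congruence.cls_surj _ p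
  obtain ⟨y, rfl⟩ := Congruence.cls_surj _ q
  by_cases hx : x ∈ Set.Icc (bot' A) (f A ^ 2)
  · by_cases hy : y ∈ Set.Icc (bot' A) (f A ^ 2)
    · rw [(cls_eq_one_iff h1 x).2 hx, (cls_eq_one_iff h1 y).2 hy]
      exact .inl le_rfl
    · exact ((le_total_of_notMem hA h1 x hy).imp (Congruence.cls_mono _)
        (Congruence.cls_mono _)).symm
  · exact (le_total_of_notMem hA h1 y hx).imp (Congruence.cls_mono _) (Congruence.cls_mono _)

end Interval

/-! ### The isomorphism with the rigorous extension. -/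

section Isomorphism

variable {A : Type u} [DeMorganMonoid A]

open Classical in
/-- The map from `A` to the rigorous extension of its interval subalgebra by its top factor. -/
noncomputable def toRigorousExtension (h1 : 1 ≤ f A ^ 2)
    (hS : IsTotallyOrderedOddSugihara (TopFactor A)) (x : A) :
    RigorousExtension (TopFactor A) (SubalgType (intervalSubalg h1)) hS :=
  if h : x ∈ Set.Icc (bot' A) (f A ^ 2) then Sum.inr ⟨x, h⟩
  else Sum.inl ⟨(topFilter A).leibniz.cls x, fun k => h ((cls_eq_one_iff h1 x).1 k)⟩

variable (h1 : 1 ≤ f A ^ 2) (hS : IsTotallyOrderedOddSugihara (TopFactor A))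

theorem toRigorousExtension_of_mem {x : A} (h : x ∈ Set.Icc (bot' A) (f A ^ 2)) :
    toRigorousExtension h1 hS x = Sum.inr ⟨x, h⟩ := dif_pos h

theorem toRigorousExtension_of_notMem {x : A} (h : x ∉ Set.Icc (bot' A) (f A ^ 2)) :
    toRigorousExtension h1 hS x =
      Sum.inl ⟨(topFilter A).leibniz.cls x, fun k => h ((cls_eq_one_iff h1 x).1 k)⟩ := dif_neg h

theorem toRigorousExtension_bijective (hA : IsFSI A) :
    Function.Bijective (toRigorousExtension h1 hS) := by
  constructor
  · intro x y hxy
    by_cases hx : x ∈ Set.Icc (bot' A) (f A ^ 2) <;>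
    by_cases hy : y ∈ Set.Icc (bot' A) (f A ^ 2)
    · rw [toRigorousExtension_of_mem h1 hS hx, toRigorousExtension_of_mem h1 hS hy] at hxy
      exact congrArg Subtype.val (Sum.inr_injective hxy)
    · rw [toRigorousExtension_of_mem h1 hS hx, toRigorousExtension_of_notMem h1 hS hy] at hxy
      cases hxy
    · rw [toRigorousExtension_of_notMem h1 hS hx, toRigorousExtension_of_mem h1 hS hy] at hxy
      cases hxy
    · rw [toRigorousExtension_of_notMem h1 hS hx, toRigorousExtension_of_notMem h1 hS hy] at hxy
      exact eq_of_cls_eq hA h1 hx hy (congrArg Subtype.val (Sum.inl_injective hxy))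
  · rintro (⟨s, hs⟩ | ⟨b, hb⟩)
    · obtain ⟨x, rfl⟩ := Congruence.cls_surj _ s
      exact ⟨x, toRigorousExtension_of_notMem h1 hS fun k => hs ((cls_eq_one_iff h1 x).2 k)⟩
    · exact ⟨b, toRigorousExtension_of_mem h1 hS hb⟩

/-- A mixed product is the image of `x ⋆ y`, provided that `x ⋆ y = x` when `x ⋆ y` is in the
interval. -/
theorem toRigorousExtension_mixed {opA : A → A → A}
    {opS : TopFactor A → TopFactor A → TopFactor A} {x y : A}
    (hx : x ∈ Set.Icc (bot' A) (f A ^ 2)) (hy : y ∉ Set.Icc (bot' A) (f A ^ 2))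
    (hcls : (topFilter A).leibniz.cls (opA x y) =
      opS ((topFilter A).leibniz.cls x) ((topFilter A).leibniz.cls y))
    (habs : opA x y ∈ Set.Icc (bot' A) (f A ^ 2) → opA x y = x) :
    toRigorousExtension h1 hS (opA x y) =
      RigorousExtension.mixed opS ⟨x, hx⟩
        ⟨(topFilter A).leibniz.cls y, fun k => hy ((cls_eq_one_iff h1 y).1 k)⟩ := by
  rw [(cls_eq_one_iff h1 x).2 hx] at hcls
  by_cases h : opA x y ∈ Set.Icc (bot' A) (f A ^ 2)
  · refine (toRigorousExtension_of_mem h1 hS h).trans (Eq.trans ?_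
      (dif_pos (hcls ▸ (cls_eq_one_iff h1 _).2 h)).symm)
    exact congrArg Sum.inr (Subtype.ext (habs h))
  · refine (toRigorousExtension_of_notMem h1 hS h).trans (Eq.trans ?_
      (dif_neg (hcls ▸ fun k => h ((cls_eq_one_iff h1 _).1 k))).symm)
    exact congrArg Sum.inl (Subtype.ext hcls)

/-- Treats fusion, meet and join uniformly; only `habs`, the mixed case that falls back into the
interval, depends on the operation. -/
theorem toRigorousExtension_extOp {opA : A → A → A}
    {opS : TopFactor A → TopFactor A → TopFactor A}
    {opB : SubalgType (intervalSubalg h1) → SubalgType (intervalSubalg h1) →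
      SubalgType (intervalSubalg h1)}
    (hop : ∀ s p : TopFactor A, s ≠ 1 → p ≠ 1 → opS s p ≠ 1)
    (hcomm : ∀ x y, opA x y = opA y x)
    (hcls : ∀ x y, (topFilter A).leibniz.cls (opA x y) =
      opS ((topFilter A).leibniz.cls x) ((topFilter A).leibniz.cls y))
    (hval : ∀ x y, (opB x y).1 = opA x.1 y.1)
    (habs : ∀ x y, x ∈ Set.Icc (bot' A) (f A ^ 2) → y ∉ Set.Icc (bot' A) (f A ^ 2) →
      opA x y ∈ Set.Icc (bot' A) (f A ^ 2) → opA x y = x) (x y : A) :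
    toRigorousExtension h1 hS (opA x y) = RigorousExtension.extOp opS opB hop
      (toRigorousExtension h1 hS x) (toRigorousExtension h1 hS y) := by
  by_cases hx : x ∈ Set.Icc (bot' A) (f A ^ 2) <;>
  by_cases hy : y ∈ Set.Icc (bot' A) (f A ^ 2)
  · have hxy : opA x y ∈ Set.Icc (bot' A) (f A ^ 2) :=
      hval ⟨x, hx⟩ ⟨y, hy⟩ ▸ (opB ⟨x, hx⟩ ⟨y, hy⟩).2
    rw [toRigorousExtension_of_mem h1 hS hx, toRigorousExtension_of_mem h1 hS hy,
      toRigorousExtension_of_mem h1 hS hxy]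
    exact congrArg Sum.inr (Subtype.ext (hval ⟨x, hx⟩ ⟨y, hy⟩).symm)
  · rw [toRigorousExtension_of_mem h1 hS hx, toRigorousExtension_of_notMem h1 hS hy]
    exact toRigorousExtension_mixed h1 hS hx hy (hcls x y) (habs x y hx hy)
  · rw [toRigorousExtension_of_notMem h1 hS hx, toRigorousExtension_of_mem h1 hS hy, hcomm]
    exact toRigorousExtension_mixed h1 hS hy hx (hcls y x) (habs y x hy hx)
  · have hxy : opA x y ∉ Set.Icc (bot' A) (f A ^ 2) := by
      rw [← cls_eq_one_iff h1, hcls]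
      exact hop _ _ (mt (cls_eq_one_iff h1 x).1 hx) (mt (cls_eq_one_iff h1 y).1 hy)
    rw [toRigorousExtension_of_notMem h1 hS hx, toRigorousExtension_of_notMem h1 hS hy,
      toRigorousExtension_of_notMem h1 hS hxy]
    exact congrArg Sum.inl (Subtype.ext (hcls x y))

/-- A non-idempotent FSI De Morgan monoid is the rigorous extension of its interval subalgebra
by its top factor. -/
noncomputable def rigorousExtensionIso (hA : IsFSI A) :
    IRLIso A (RigorousExtension (TopFactor A) (SubalgType (intervalSubalg h1)) hS) where
  toEquiv := Equiv.ofBijective _ (toRigorousExtension_bijective h1 hS hA)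
  map_mul' := toRigorousExtension_extOp h1 hS _ mul_comm (fun _ _ => rfl) (fun _ _ => rfl)
    -- For fusion this case is vacuous: the product is `y`, which is outside the interval.
    fun x y hx hy h => absurd (by rwa [mul_comm, mul_eq_of_notMem hA h1 hy hx] at h) hy
  map_inf' := toRigorousExtension_extOp h1 hS _ inf_comm (fun _ _ => rfl) (fun _ _ => rfl)
    fun x y hx hy h => (le_total_of_notMem hA h1 x hy).elim
      (fun k => absurd (inf_eq_right.2 k ▸ h) hy) inf_eq_left.2
  map_sup' := toRigorousExtension_extOp h1 hS _ sup_comm (fun _ _ => rfl) (fun _ _ => rfl)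
    fun x y hx hy h => (le_total_of_notMem hA h1 x hy).elim
      sup_eq_left.2 (fun k => absurd (sup_eq_right.2 k ▸ h) hy)
  map_neg' := by
    intro x
    change toRigorousExtension h1 hS (-x) = -toRigorousExtension h1 hS x
    by_cases hx : x ∈ Set.Icc (bot' A) (f A ^ 2)
    · rw [toRigorousExtension_of_mem h1 hS hx, toRigorousExtension_of_mem h1 hS (mem_Icc_neg hx)]
      rfl
    · rw [toRigorousExtension_of_notMem h1 hS hx,
        toRigorousExtension_of_notMem h1 hS fun k => hx (neg_neg x ▸ mem_Icc_neg k)]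
      rfl
  map_one' := toRigorousExtension_of_mem h1 hS ⟨bot'_le_one, h1⟩

end Isomorphism

end DeMorganMonoid

/-! ### The dichotomy. -/

open IRL DeMorganMonoid in
theorem mainTheorem8 {A : Type*} [DeMorganMonoid A] (hA : IRL.IsFSI A) :
    Xor
      (DeMorganMonoid.IsSugihara A)
      (∃ (A' : IRL.Subalg A)
          (hS : DeMorganMonoid.IsTotallyOrderedOddSugihara (DeMorganMonoid.TopFactor A)),
        A'.carrier = Set.Icc (-(IRL.f A ^ 2)) (IRL.f A ^ 2) ∧
        Nontrivial (DeMorganMonoid.SubalgType A') ∧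
        DeMorganMonoid.IsAntiIdempotent (DeMorganMonoid.SubalgType A') ∧
        Nonempty (IRLIso A
          (DeMorganMonoid.RigorousExtension (DeMorganMonoid.TopFactor A)
            (DeMorganMonoid.SubalgType A') hS))) := by
  by_cases hs : IsSugihara A
  · refine .inl ⟨hs, ?_⟩
    rintro ⟨A', -, hc, ⟨⟨x, hx⟩, ⟨y, hy⟩, hne⟩, -⟩
    -- With `f² = f ≤ 1` and `-f = 1`, the interval collapses to `{1}`, contradicting nontriviality.
    have key : ∀ z ∈ A'.carrier, z = 1 := by
      intro z hz
      rw [hc, hs (f A)] at hz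
      refine le_antisymm (hz.2.trans hs.f_le_one) ?_
      simpa [f] using hz.1
    exact hne (Subtype.ext ((key x hx).trans (key y hy).symm))
  · have h1 := one_le_f_sq hA hs
    have hS := isTotallyOrderedOddSugihara_topFactor hA h1
    refine .inr ⟨⟨intervalSubalg h1, hS, rfl, ?_, fun x => x.2.2,
      ⟨rigorousExtensionIso h1 hS hA⟩⟩, hs⟩
    -- If `1 = f` in the subalgebra, then `f ≤ 1` in `A`, forcing idempotence.
    refine ⟨1, f _, fun h => hs (isSugihara_of_f_le_one ?_)⟩
    exact (congrArg Subtype.val h).ge
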